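/- **Setting.** Let $X$ be a finite simple graph with vertex set $V$, and let $W=(w_{ab})$ be a complex $V\times V$ matrix such that $w_{ab}\neq 0$ if and only if $a$ and $b$ are adjacent, and $\sum_b |w_{ab}|^2=1$ for every $a\in V$. Each edge $\{a,b\}$ gives two arcs $(a,b)$ and $(b,a)$. Let $R$ be the permutation matrix on the arcs exchanging $(a,b)$ and $(b,a)$, let $N_t$ be the $V\times\{\text{arcs}\}$ matrix with $(N_t)_{u,(a,b)}=w_{ab}$ if $u=a$ and $0$ otherwise, and let $$U=R\,(2N_t^*N_t-I),\qquad H=W\circ W^*,\quad\text{i.e. } H_{ab}=w_{ab}\overline{w_{ba}} .$$ Then $U$ is unitary and $H$ is Hermitian. There is *pretty good state transfer* from $x$ to $y$ if there is $\gamma\in\mathbb C$ with $|\gamma|=1$ such that for every $\epsilon>0$ there is $t\in\mathbb Z$ with $\|U^tx-\gamma y\|<\epsilon$. For real $\lambda$ let $E_\lambda$ be the orthogonal projection onto the $\lambda$-eigenspace of $H$, let $e_a$ be the characteristic vector of the vertex $a$, and let $\Lambda_a=\{\lambda: E_\lambda e_a\neq 0\}$. For a positive integer $m$, vertices $a$ and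 $b$ are *$m$-strongly cospectral* (relative to $H$) if for each $\lambda\in\Lambda_a$ there is an $m$-th root of unity $\alpha_\lambda$ with $E_\lambda e_a=\alpha_\lambda E_\lambda e_b$, and at least one of the $\alpha_\lambda$ is a primitive $m$-th root of unity. For $k\in\mathbb Z_m$ put $$\Lambda_{ab}^k=\{\lambda\in\Lambda_a: E_\lambda e_a=e^{2\pi i k/m}E_\lambda e_b\}.$$ **Theorem.** Let $a$ and $b$ be $m$-strongly cospectral vertices. Let $\beta_{1}=1$ if $1\in\Lambda_a$ and $\beta_1=0$ otherwise, and let $\beta_{-1}=1$ if $-1\in\Lambda_a$ and $\beta_{-1}=0$ otherwise. If $1\in\Lambda_a$ let $\sigma_1$ be the index with $1\in\Lambda_{ab}^{\sigma_1}$, and if $-1\in\Lambda_a$ let $\sigma_{-1}$ be the index with $-1\in\Lambda_{ab}^{\sigma_{-1}}$ (otherwise these numbers are arbitrary integers). Then pretty good state transfer occurs from $N_t^*e_a$ to $N_t^*e_b$ if and only if it occurs from $N_t^*e_b$ to $N_t^*e_a$, and this happens if and only if for all integers $\ell_\lambda,\ell'_\lambda$ ($\lambda\in\Lambda_a\setminus\{1,-1\}$)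 and $\ell_1,\ell_{-1}$, the two conditions $$\sum_{\lambda\in\Lambda_a\setminus\{\pm1\}}(\ell_\lambda-\ell'_\lambda)\arccos(\lambda)+\ell_{-1}\beta_{-1}\pi\equiv 0\pmod{2\pi}$$ and $$\sum_{\lambda\in\Lambda_a\setminus\{\pm1\}}(\ell_\lambda+\ell'_\lambda)+\ell_1\beta_1+\ell_{-1}\beta_{-1}=0$$ imply $$\sum_{k=0}^{m-1}k\Bigl(\sum_{\lambda\in\Lambda_{ab}^k\setminus\{\pm1\}}(\ell_\lambda+\ell'_\lambda)\Bigr)+\ell_1\beta_1\sigma_1+\ell_{-1}\beta_{-1}\sigma_{-1}\equiv 0\pmod m .$$ -/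

import Mathlib

open scoped Matrix

noncomputable section

namespace QuantumWalk

variable {V : Type*} [Fintype V] [DecidableEq V]

/-- `W` is a normalized complex adjacency matrix of the graph `G`: its nonzero entries are exactly
those at pairs of adjacent vertices, and the entrywise product of `W` with its entrywise complex
conjugate has all row sums equal to one. -/
structure IsNormalizedAdjacency (G : SimpleGraph V) (W : Matrix V V ℂ) : Prop where
  ne_zero_iff : ∀ a b, W a b ≠ 0 ↔ G.Adj a b
  row_stochastic : (W ⊙ W.map star) *ᵥ 1 = 1

/-- The Hermitian adjacency matrix `H = W ∘ W*` (entrywise product with the conjugate transpose). -/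
def hermitianAdjacency (W : Matrix V V ℂ) : Matrix V V ℂ := W ⊙ Wᴴ

section Walk

variable (G : SimpleGraph V) [DecidableRel G.Adj]

/-- The permutation matrix `R` that reverses every arc. Arcs are the darts of `G`. -/
def arcReversal : Matrix G.Dart G.Dart ℂ :=
  Matrix.of fun d e => if d = e.symm then 1 else 0

/-- The weighted tail-arc incidence matrix `N_t`: the entry at vertex `u` and arc `(a, b)` is
`W a b` if `u = a` and zero otherwise. -/
def tailIncidence (W : Matrix V V ℂ) : Matrix V G.Dart ℂ :=
  Matrix.of fun u d => if u = d.fst then W d.fst d.snd else 0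

/-- The transition matrix `U = R (2 N_t* N_t - I)` of the quantum walk. -/
def transition (W : Matrix V V ℂ) : Matrix G.Dart G.Dart ℂ :=
  arcReversal G * ((2 : ℂ) • ((tailIncidence G W)ᴴ * tailIncidence G W) - 1)

/-- The state `N_t* e_a` concentrated on the outgoing arcs of the vertex `a`. -/
def vertexState (W : Matrix V V ℂ) (a : V) : G.Dart → ℂ :=
  (tailIncidence G W)ᴴ *ᵥ Pi.single a 1

end Walk

/-- Pretty good state transfer from `x` to `y` under a unitary matrix `U`: for one unimodular `γ`,
some integer powers of `U` send `x` arbitrarily close to `γ y`, in the Euclidean norm. -/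
def PrettyGoodStateTransfer {ι : Type*} [Fintype ι] [DecidableEq ι]
    (U : Matrix ι ι ℂ) (x y : ι → ℂ) : Prop :=
  ∃ γ : ℂ, ‖γ‖ = 1 ∧ ∀ ε : ℝ, 0 < ε → ∃ t : ℤ,
    ‖WithLp.toLp 2 ((U ^ t) *ᵥ x - γ • y)‖ < ε

/-- `eigenProj H l a` is `E_l e_a`: the orthogonal projection of the characteristic vector of `a`
onto the `l`-eigenspace of `H`. It is zero if `l` is not an eigenvalue. -/
def eigenProj (H : Matrix V V ℂ) (l : ℝ) (a : V) : EuclideanSpace ℂ V :=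
  (Module.End.eigenspace (Matrix.toEuclideanLin H) (l : ℂ)).starProjection
    (EuclideanSpace.single a 1)

theorem finite_eigenProj_ne_zero (H : Matrix V V ℂ) (a : V) :
    {l : ℝ | eigenProj H l a ≠ 0}.Finite := by
  have h := (Module.End.finite_hasEigenvalue (Matrix.toEuclideanLin H)).preimage
    (Complex.ofReal_injective.injOn)
  refine h.subset fun l hl => ?_
  intro hbot
  apply hl
  have hb : Module.End.eigenspace (Matrix.toEuclideanLin H) (l : ℂ) = ⊥ := hbot
  simp [eigenProj, hb]

/-- The eigenvalue support `Λ_a` of the vertex `a` relative to the Hermitian matrix `H`. -/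
def eigenvalueSupport (H : Matrix V V ℂ) (a : V) : Finset ℝ :=
  (finite_eigenProj_ne_zero H a).toFinset

/-- The vertices `a` and `b` are `m`-strongly cospectral relative to `H`, for a positive integer
`m`: on the eigenvalue support of `a`, `E_l e_a = α_l E_l e_b` where each `α_l` is an `m`-th root
of unity (hence unimodular) and at least one of them is primitive. -/
def MStronglyCospectral (H : Matrix V V ℂ) (m : ℕ) (a b : V) : Prop :=
  0 < m ∧ ∃ α : ℝ → ℂ,
    (∀ l ∈ eigenvalueSupport H a, α l ^ m = 1 ∧ eigenProj H l a = α l • eigenProj H l b) ∧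
    ∃ l ∈ eigenvalueSupport H a, IsPrimitiveRoot (α l) m

open Classical in
/-- The class `Λ_ab^k` of those `l` in `Λ_a` with `E_l e_a = exp (2 π i k / m) E_l e_b`.
It depends on `k` only modulo `m`. -/
def phaseClass (H : Matrix V V ℂ) (m : ℕ) (a b : V) (k : ℤ) : Finset ℝ :=
  (eigenvalueSupport H a).filter fun l =>
    eigenProj H l a = Complex.exp (2 * Real.pi * Complex.I * k / m) • eigenProj H l b

/-- `β_l` is one if `l` lies in the eigenvalue support of `a`, and zero otherwise. -/
def supportIndicator (H : Matrix V V ℂ) (a : V) (l : ℝ) : ℤ :=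
  if l ∈ eigenvalueSupport H a then 1 else 0

end QuantumWalk

end

open QuantumWalk

/-!
For an eigenvector `f` of `H` with eigenvalue `x = cos θ`, the vectors `N* f` and `R N* f` span a
subspace invariant under `U`, because `N N* = 1` and `N R N* = H`; there `U` has the eigenvalues
`exp (± i θ)`, and `N* f` is the sum of one eigenvector for each (`exists_lift_eigenvectors`).
Decompose `e_a` and `e_b` over the eigenspaces of `H`. Strong cospectrality makes their components
differ by phases, so both have the same eigenvalue support. Pairing `U^t N* e_a - γ N* e_b` with
the eigenvectors of `U` shows that state transfer from `a` to `b` means the following: for one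
unimodular `γ` and suitable integers `t`, all numbers `exp (± i t arccos x) α_x` with `x` in the
support come close to `γ` at once (`prettyGoodStateTransfer_iff_exists_phase`).

This is a problem of Kronecker type on a finite torus (`exists_zpow_mul_near_const_iff`): the
vector of phases has to lie in the closed subgroup `K` generated by the vector of eigenvalues and
the diagonal circle. A closed subgroup of a torus is cut out by the characters trivial on it
(`mem_of_forall_torusChar_eq_one`), which follows from Haar measure on the subgroup and the density
of trigonometric polynomials. A character is a vector of integers `(l_x, l'_x)`. It is trivial on
the eigenvalue vector iff `∑ (l_x - l'_x) arccos x` is a multiple of `2 π`, on the diagonal circle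
iff `∑ (l_x + l'_x) = 0`, and on the vector of `m`-th roots of unity iff the weighted sum of the
class indices is divisible by `m`. The eigenvalues `±1`, whose two angles coincide modulo `2 π`,
need only one integer each (`forall_int_iff_separate_pm_one`).

The equivalence of the two directions of transfer holds for every unitary matrix: replace `t` by
`-t`.
-/

/-! ### Characters of a finite torus and Kronecker's theorem -/

/-- The character `z ↦ ∏ j, z j ^ n j` of the torus `ι → Circle`, as a homomorphism. -/
noncomputable def torusChar {ι : Type*} [Fintype ι] (n : ι → ℤ) : (ι → Circle) →* Circle where
  toFun z := ∏ j, z j ^ n j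
  map_one' := by simp
  map_mul' x y := by simp [mul_zpow, Finset.prod_mul_distrib]

theorem torusChar_apply {ι : Type*} [Fintype ι] (n : ι → ℤ) (z : ι → Circle) :
    torusChar n z = ∏ j, z j ^ n j := rfl

theorem continuous_torusChar {ι : Type*} [Fintype ι] (n : ι → ℤ) :
    Continuous (torusChar n) := by
  have : (torusChar n : (ι → Circle) → Circle) = fun z => ∏ j, z j ^ n j := rfl
  rw [this]
  fun_prop

/-- The character of the torus with exponents `n`, as a complex-valued continuous function. -/
noncomputable def torusCharMap {ι : Type*} [Fintype ι] (n : ι → ℤ) : C(ι → Circle, ℂ) where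
  toFun z := (torusChar n z : ℂ)
  continuous_toFun := continuous_subtype_val.comp (continuous_torusChar n)

/-- Trigonometric polynomials are dense among the continuous functions on a finite torus. -/
theorem dense_span_torusCharMap (ι : Type*) [Fintype ι] :
    Dense (Submodule.span ℂ (Set.range (torusCharMap (ι := ι))) : Set C(ι → Circle, ℂ)) := by
  classical
  let M : Submonoid C(ι → Circle, ℂ) :=
    { carrier := Set.range torusCharMap
      one_mem' := ⟨0, by ext z; simp [torusCharMap, torusChar_apply]⟩
      mul_mem' := by
        rintro _ _ ⟨n, rfl⟩ ⟨k, rfl⟩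
        refine ⟨n + k, ?_⟩
        ext z
        simp [torusCharMap, torusChar_apply, zpow_add, Finset.prod_mul_distrib] }
  have hM : (M : Set C(ι → Circle, ℂ)) = Set.range torusCharMap := rfl
  have hstar : ∀ f ∈ (M : Set C(ι → Circle, ℂ)), star f ∈ (M : Set C(ι → Circle, ℂ)) := by
    rintro _ ⟨n, rfl⟩
    refine ⟨-n, ?_⟩
    ext z
    have h : (torusChar (-n) z : Circle) = (torusChar n z)⁻¹ := by
      simp [torusChar_apply]
    simp only [torusCharMap, ContinuousMap.coe_mk, ContinuousMap.star_apply]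
    rw [h, Circle.coe_inv_eq_conj]
    rfl
  have hMstar : star (M : Set C(ι → Circle, ℂ)) ⊆ M := fun f hf => by
    have := hstar _ hf
    rwa [star_star] at this
  have hA : (StarAlgebra.adjoin ℂ (M : Set C(ι → Circle, ℂ))).SeparatesPoints := by
    intro x y hxy
    obtain ⟨j, hj⟩ := Function.ne_iff.mp hxy
    refine ⟨_, ⟨torusCharMap (Pi.single j 1),
      StarAlgebra.subset_adjoin ℂ _ ⟨Pi.single j 1, rfl⟩, rfl⟩, ?_⟩
    have key : ∀ z : ι → Circle, torusChar (Pi.single j 1) z = z j := fun z => by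
      rw [torusChar_apply, Finset.prod_eq_single j]
      · simp
      · intro i _ hi; simp [hi]
      · simp
    simpa [torusCharMap, key, Circle.coe_inj] using hj
  have htop := ContinuousMap.starSubalgebra_topologicalClosure_eq_top_of_separatesPoints _ hA
  have hspan : ((StarAlgebra.adjoin ℂ (M : Set C(ι → Circle, ℂ)) : StarSubalgebra ℂ _) :
      Set C(ι → Circle, ℂ)) = Submodule.span ℂ (Set.range (torusCharMap (ι := ι))) := by
    have h1 : (StarAlgebra.adjoin ℂ (M : Set C(ι → Circle, ℂ))).toSubalgebra
        = Algebra.adjoin ℂ (M : Set C(ι → Circle, ℂ)) := by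
      rw [StarAlgebra.adjoin_toSubalgebra, Set.union_eq_self_of_subset_right hMstar]
    have h2 := Algebra.adjoin_eq_span ℂ (M : Set C(ι → Circle, ℂ))
    rw [Submonoid.closure_eq, hM] at h2
    rw [← h2, ← hM, ← h1]
    rfl
  rw [← hspan, dense_iff_closure_eq]
  have := congrArg (fun S : StarSubalgebra ℂ C(ι → Circle, ℂ) => (S : Set C(ι → Circle, ℂ))) htop
  simpa using this

open MeasureTheory in
/-- Duality for closed subgroups of a finite torus: a point that every character trivial on the
closed subgroup `K` sends to `1` lies in `K`. Otherwise a continuous function vanishes on `K` and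
is `1` on the coset `p K`; but trigonometric polynomials have the same mean over both. -/
theorem mem_of_forall_torusChar_eq_one {ι : Type*} [Fintype ι] (K : Subgroup (ι → Circle))
    (hK : IsClosed (K : Set (ι → Circle))) (p : ι → Circle)
    (h : ∀ n : ι → ℤ, (∀ k ∈ K, torusChar n k = 1) → torusChar n p = 1) : p ∈ K := by
  by_contra hp
  have : CompactSpace K := isCompact_iff_compactSpace.mp hK.isCompact
  let : MeasurableSpace K := borel K
  have : BorelSpace K := ⟨rfl⟩
  let μ : Measure K := Measure.haarMeasure ⊤
  have : IsProbabilityMeasure μ := ⟨by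
    simpa using Measure.haarMeasure_self (K₀ := (⊤ : TopologicalSpace.PositiveCompacts K))⟩
  have hint : ∀ (f : C(ι → Circle, ℂ)) (q : ι → Circle),
      Integrable (fun k : K => f (q * k)) μ := fun f q => by
    refine Continuous.integrable_of_hasCompactSupport (by fun_prop) ?_
    exact HasCompactSupport.of_compactSpace _
  have hchar : ∀ n : ι → ℤ, ∫ k : K, torusCharMap n (p * k) ∂μ = ∫ k : K, torusCharMap n k ∂μ := by
    intro n
    have hmul : ∀ x y : ι → Circle,
        torusCharMap n (x * y) = torusCharMap n x * torusCharMap n y := by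
      intro x y; simp [torusCharMap]
    by_cases hn : ∀ k ∈ K, torusChar n k = 1
    -- a character trivial on `K` is trivial at `p`; any other one has mean zero over `K` and `p K`
    · have : torusCharMap n p = 1 := by simp [torusCharMap, h n hn]
      simp [hmul, this]
    · push Not at hn
      obtain ⟨k₀, hk₀, hne⟩ := hn
      have hinv := integral_mul_left_eq_self (μ := μ) (fun k : K => torusCharMap n k) ⟨k₀, hk₀⟩
      simp only [Subgroup.coe_mul, hmul, integral_const_mul] at hinv
      have hne' : torusCharMap n k₀ ≠ 1 := by
        simpa [torusCharMap, Circle.coe_eq_one] using hne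
      have h0 : ∫ k : K, torusCharMap n k ∂μ = 0 := by
        by_contra h0
        exact hne' (mul_right_cancel₀ h0 (by rw [hinv, one_mul]))
      simp [hmul, integral_const_mul, h0]
  have hspan : ∀ g ∈ Submodule.span ℂ (Set.range (torusCharMap (ι := ι))),
      ∫ k : K, g (p * k) ∂μ = ∫ k : K, g k ∂μ := by
    intro g hg
    have hint' : ∀ f : C(ι → Circle, ℂ), Integrable (fun k : K => f k) μ := fun f => by
      simpa using hint f 1
    induction hg using Submodule.span_induction with
    | mem x hx => obtain ⟨n, rfl⟩ := hx; exact hchar n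
    | zero => simp
    | add x y _ _ hx hy =>
      simp only [ContinuousMap.add_apply]
      rw [integral_add (hint x p) (hint y p), integral_add (hint' x) (hint' y), hx, hy]
    | smul c x _ hx =>
      simp only [ContinuousMap.smul_apply, integral_smul, hx]
  have hcoset : IsClosed ((fun z => p * z) '' (K : Set (ι → Circle))) :=
    (Homeomorph.mulLeft p).isClosedMap _ hK
  have hdisj : Disjoint (K : Set (ι → Circle)) ((fun z => p * z) '' (K : Set (ι → Circle))) := by
    rw [Set.disjoint_left]
    rintro _ hx ⟨k, hk, rfl⟩
    exact hp ((Subgroup.mul_mem_cancel_right K hk).mp hx)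
  obtain ⟨f, hf0, hf1, -⟩ := exists_continuous_zero_one_of_isClosed hK hcoset hdisj
  let F : C(ι → Circle, ℂ) := ⟨fun z => (f z : ℂ), by fun_prop⟩
  obtain ⟨g, hg, hFg⟩ := Metric.dense_iff.mp (dense_span_torusCharMap ι) F (1 / 3) (by norm_num)
  have hclose : ∀ z, ‖g z - F z‖ ≤ 1 / 3 := fun z => by
    have := ContinuousMap.dist_apply_le_dist (f := g) (g := F) z
    rw [dist_eq_norm] at this
    exact this.trans (Metric.mem_ball.mp hg).le
  have e0 : ‖∫ k : K, g k ∂μ‖ ≤ 1 / 3 := by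
    have := norm_integral_le_of_norm_le_const (μ := μ) (f := fun k : K => g k) (C := 1 / 3)
      (Filter.Eventually.of_forall fun k => by
        have h1 := hclose k
        have h2 : F k = 0 := by simp [F, hf0 k.2]
        rwa [h2, sub_zero] at h1)
    simpa using this
  have e1 : ‖∫ k : K, (g (p * k) - 1) ∂μ‖ ≤ 1 / 3 := by
    have := norm_integral_le_of_norm_le_const (μ := μ) (f := fun k : K => g (p * k) - 1)
      (C := 1 / 3) (Filter.Eventually.of_forall fun k => by
        have h1 := hclose (p * k)
        have h2 : F (p * k) = 1 := by
          have := hf1 ⟨(k : ι → Circle), k.2, rfl⟩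
          simp only [Pi.one_apply] at this
          simp [F, this]
        rwa [h2] at h1)
    simpa using this
  rw [integral_sub (hint g p) (integrable_const 1), hspan g hFg] at e1
  simp only [integral_const, probReal_univ, one_smul] at e1
  have h3 := norm_sub_le (∫ k : K, g k ∂μ) (∫ k : K, g k ∂μ - 1)
  rw [sub_sub_cancel, norm_one] at h3
  linarith

/-- Kronecker's theorem with a free common phase: the integer powers of `u` come arbitrarily close
to a scalar multiple of `p⁻¹` on the torus exactly if every character of exponent sum zero that is
trivial at `u` is trivial at `p`. -/
theorem exists_zpow_mul_near_const_iff {ι : Type*} [Fintype ι] (u p : ι → Circle) :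
    (∃ γ : Circle, ∀ ε : ℝ, 0 < ε → ∃ t : ℤ, ∀ j, ‖(u j : ℂ) ^ t * p j - γ‖ < ε) ↔
      ∀ n : ι → ℤ, torusChar n u = 1 → ∑ j, n j = 0 → torusChar n p = 1 := by
  have hconst : ∀ (n : ι → ℤ) (g : Circle), torusChar n (fun _ => g) = g ^ ∑ j, n j := by
    intro n g
    rw [torusChar_apply]
    classical
    exact Finset.induction_on (motive := fun s => ∏ j ∈ s, g ^ n j = g ^ ∑ j ∈ s, n j)
      Finset.univ (by simp) fun i s hi ih => by
        rw [Finset.prod_insert hi, Finset.sum_insert hi, ih, zpow_add]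
  have hdist : ∀ x y : Circle, dist x y = ‖(y : ℂ) - x‖ := fun x y => by
    rw [dist_comm]
    exact dist_eq_norm (y : ℂ) x
  constructor
  · rintro ⟨γ, hγ⟩ n hu hn
    have hmem : (fun _ => γ : ι → Circle) ∈ closure (Set.range fun t : ℤ => u ^ t * p) := by
      rw [Metric.mem_closure_iff]
      intro ε hε
      obtain ⟨t, ht⟩ := hγ ε hε
      refine ⟨_, ⟨t, rfl⟩, (dist_pi_lt_iff hε).mpr fun j => ?_⟩
      rw [hdist]
      exact ht j
    have hcl : IsClosed {z : ι → Circle | torusChar n z = torusChar n p} :=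
      isClosed_eq (continuous_torusChar n) continuous_const
    have hsub : (Set.range fun t : ℤ => u ^ t * p) ⊆ {z | torusChar n z = torusChar n p} := by
      rintro _ ⟨t, rfl⟩
      simp [map_mul, map_zpow, hu]
    have := closure_minimal hsub hcl hmem
    simp only [Set.mem_ofPred_eq, hconst, hn, zpow_zero] at this
    exact this.symm
  · intro h
    -- `D` is the diagonal circle and `Z` the closure of the powers of `u`; both are compact
    let D : Subgroup (ι → Circle) :=
      { carrier := Set.range fun g : Circle => (fun _ => g : ι → Circle)
        one_mem' := ⟨1, rfl⟩
        mul_mem' := by rintro _ _ ⟨x, rfl⟩ ⟨y, rfl⟩; exact ⟨x * y, rfl⟩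
        inv_mem' := by rintro _ ⟨x, rfl⟩; exact ⟨x⁻¹, rfl⟩ }
    let Z := (Subgroup.zpowers u).topologicalClosure
    have hDc : IsCompact (D : Set (ι → Circle)) :=
      isCompact_range (f := fun g : Circle => (fun _ => g : ι → Circle)) (by fun_prop)
    have hZc : IsCompact (Z : Set (ι → Circle)) :=
      (Subgroup.isClosed_topologicalClosure _).isCompact
    have hK : IsClosed ((Z ⊔ D : Subgroup (ι → Circle)) : Set (ι → Circle)) := by
      rw [Subgroup.mul_normal]
      exact (hZc.mul hDc).isClosed
    have hp : p⁻¹ ∈ Z ⊔ D := by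
      refine mem_of_forall_torusChar_eq_one _ hK _ fun n hn => ?_
      have hu : torusChar n u = 1 :=
        hn u (Subgroup.mem_sup_left (Subgroup.le_topologicalClosure _
          (Subgroup.mem_zpowers u)))
      have hs : ∑ j, n j = 0 := by
        by_contra hne
        -- a rotation by `1 / s` radians is not trivialized by the `s`-th power
        have h1 := hn (fun _ => Circle.exp (1 / ((∑ j, n j : ℤ) : ℝ)))
          (Subgroup.mem_sup_right ⟨_, rfl⟩)
        have hne' : ((∑ j, n j : ℤ) : ℝ) ≠ 0 := by exact_mod_cast hne
        rw [hconst, ← Circle.exp_intCast_mul, mul_one_div_cancel hne', Circle.exp_eq_one] at h1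
        obtain ⟨k, hk⟩ := h1
        have hpi := Real.pi_gt_three
        rcases le_or_gt k 0 with h0 | h0
        · have : (k : ℝ) ≤ 0 := by exact_mod_cast h0
          nlinarith
        · have : (1 : ℝ) ≤ k := by exact_mod_cast h0
          nlinarith
      rw [map_inv, h n hu hs, inv_one]
    obtain ⟨z, hz, _, ⟨g, rfl⟩, hzg⟩ := Subgroup.mem_sup.mp hp
    refine ⟨g⁻¹, fun ε hε => ?_⟩
    have hz' : z ∈ closure (Subgroup.zpowers u : Set (ι → Circle)) := hz
    obtain ⟨_, ⟨t, rfl⟩, ht⟩ := Metric.mem_closure_iff.mp hz' ε hε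
    refine ⟨t, fun j => ?_⟩
    have hj := (dist_pi_lt_iff hε).mp ht j
    rw [hdist] at hj
    have hzj : z j * p j = g⁻¹ := by
      have := congrFun hzg j
      simp only [Pi.mul_apply, Pi.inv_apply] at this
      rw [eq_inv_iff_mul_eq_one, mul_right_comm, this, inv_mul_cancel]
    rw [← hzj, Circle.coe_mul, ← sub_mul, norm_mul, Circle.norm_coe, mul_one]
    exact hj

/-! ### Algebra of the transition matrix -/

theorem conjTranspose_arcReversal {V : Type*} [DecidableEq V] (G : SimpleGraph V) :
    (arcReversal G)ᴴ = arcReversal G := by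
  ext d e
  have : e = d.symm ↔ d = e.symm := by
    constructor <;> rintro rfl <;> simp
  simp [arcReversal, Matrix.conjTranspose_apply, this, apply_ite]

theorem sum_dart_eq_sum_adj {V : Type*} [Fintype V] (G : SimpleGraph V)
    [DecidableRel G.Adj] (f : V → V → ℂ) :
    ∑ d : G.Dart, f d.fst d.snd = ∑ u, ∑ v, if G.Adj u v then f u v else 0 := by
  rw [← Fintype.sum_prod_type' (f := fun u v => if G.Adj u v then f u v else 0),
    ← Finset.sum_filter]
  refine Finset.sum_bij (fun d _ => d.toProd) ?_ ?_ ?_ ?_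
  · intro d _; simp [d.adj]
  · intro d _ e _ h; exact SimpleGraph.Dart.ext _ _ h
  · intro p hp; exact ⟨⟨p, (Finset.mem_filter.mp hp).2⟩, Finset.mem_univ _, rfl⟩
  · intro d _; rfl

section Walk

variable {V : Type*} [Fintype V] [DecidableEq V] (G : SimpleGraph V) [DecidableRel G.Adj]

theorem arcReversal_mul_self : arcReversal G * arcReversal G = 1 := by
  ext d e
  simp [Matrix.mul_apply, arcReversal, Matrix.one_apply]

theorem tailIncidence_mul_conjTranspose {W : Matrix V V ℂ}
    (hW : IsNormalizedAdjacency G W) :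
    tailIncidence G W * (tailIncidence G W)ᴴ = 1 := by
  ext u v
  have h := sum_dart_eq_sum_adj G fun x y =>
    (if u = x then W x y else 0) * star (if v = x then W x y else 0)
  simp only [Matrix.mul_apply, tailIncidence, Matrix.of_apply, Matrix.conjTranspose_apply]
  rw [h, Finset.sum_eq_single u]
  · rw [Matrix.one_apply]
    by_cases huv : u = v
    · subst huv
      have hrow := congrFun hW.row_stochastic u
      simp only [Matrix.mulVec, dotProduct, Pi.one_apply, mul_one] at hrow
      rw [if_pos rfl, ← hrow]
      refine Finset.sum_congr rfl fun y _ => ?_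
      by_cases hy : G.Adj u y
      · simp [hy]
      · have : W u y = 0 := by
          by_contra h0; exact hy ((hW.ne_zero_iff u y).mp h0)
        simp [hy, this]
    · simp [huv, Ne.symm huv]
  · intro x _ hx
    simp [Ne.symm hx]
  · simp

theorem tailIncidence_mul_arcReversal_mul {W : Matrix V V ℂ}
    (hW : IsNormalizedAdjacency G W) :
    tailIncidence G W * (arcReversal G * (tailIncidence G W)ᴴ) = hermitianAdjacency W := by
  ext u v
  have hR : arcReversal G * (tailIncidence G W)ᴴ =
      Matrix.of fun d v => star (if v = d.snd then W d.snd d.fst else 0) := by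
    ext d v
    have : ∀ e : G.Dart, d = e.symm ↔ e = d.symm := fun e => by
      constructor <;> rintro rfl <;> simp
    simp [Matrix.mul_apply, arcReversal, tailIncidence, this]
  have h := sum_dart_eq_sum_adj G fun x y =>
    (if u = x then W x y else 0) * star (if v = y then W y x else 0)
  rw [hR]
  simp only [Matrix.mul_apply, tailIncidence, Matrix.of_apply]
  rw [h, Finset.sum_eq_single u, Finset.sum_eq_single v]
  · by_cases hy : G.Adj u v
    · simp [hermitianAdjacency, hy]
    · have : W u v = 0 := by
        by_contra h0; exact hy ((hW.ne_zero_iff u v).mp h0)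
      simp [hermitianAdjacency, hy, this]
  · intro y _ hy; simp [Ne.symm hy]
  · simp
  · intro x _ hx; simp [Ne.symm hx]
  · simp

theorem transition_mul_conjTranspose_tailIncidence {W : Matrix V V ℂ}
    (hW : IsNormalizedAdjacency G W) :
    transition G W * (tailIncidence G W)ᴴ = arcReversal G * (tailIncidence G W)ᴴ := by
  rw [transition, Matrix.mul_assoc, Matrix.sub_mul, Matrix.smul_mul, Matrix.mul_assoc,
    tailIncidence_mul_conjTranspose G hW, Matrix.mul_one, Matrix.one_mul, two_smul,
    add_sub_cancel_right]

theorem transition_mul_arcReversal_mul {W : Matrix V V ℂ}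
    (hW : IsNormalizedAdjacency G W) :
    transition G W * (arcReversal G * (tailIncidence G W)ᴴ) =
      (2 : ℂ) • (arcReversal G * (tailIncidence G W)ᴴ * hermitianAdjacency W)
        - (tailIncidence G W)ᴴ := by
  rw [transition, Matrix.mul_assoc, Matrix.sub_mul, Matrix.smul_mul,
    Matrix.mul_assoc (tailIncidence G W)ᴴ,
    tailIncidence_mul_arcReversal_mul G hW, Matrix.one_mul, Matrix.mul_sub, Matrix.mul_smul,
    ← Matrix.mul_assoc, ← Matrix.mul_assoc, arcReversal_mul_self, Matrix.one_mul]

theorem conjTranspose_transition_mul_self {W : Matrix V V ℂ}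
    (hW : IsNormalizedAdjacency G W) : (transition G W)ᴴ * transition G W = 1 := by
  have hN := tailIncidence_mul_conjTranspose G hW
  set P := (tailIncidence G W)ᴴ * tailIncidence G W with hP
  have hPP : P * P = P := by
    rw [hP, Matrix.mul_assoc, ← Matrix.mul_assoc (tailIncidence G W), hN, Matrix.one_mul]
  have hPh : Pᴴ = P := by simp [hP]
  rw [transition, ← hP, Matrix.conjTranspose_mul, conjTranspose_arcReversal, Matrix.mul_assoc,
    ← Matrix.mul_assoc (arcReversal G), arcReversal_mul_self, Matrix.one_mul]
  simp only [Matrix.conjTranspose_sub, Matrix.conjTranspose_smul, hPh, Matrix.conjTranspose_one,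
    Matrix.sub_mul, Matrix.mul_sub, Matrix.smul_mul, Matrix.mul_smul, hPP, Matrix.mul_one,
    Matrix.one_mul, star_ofNat]
  module

/-! ### Lifting eigenvectors of `H` to the walk -/

/-- For an eigenvector `f` of `H` with eigenvalue `x`, the vectors `R N* f` and `N* f` have inner
product `x ‖f‖²` and norm `‖f‖` each; this gives the norm of `d = R N* f - x N* f`. So `x² ≤ 1`, and
`R N* f = x N* f` if `x = ±1`. -/
theorem star_dotProduct_lift_sub {W : Matrix V V ℂ}
    (hW : IsNormalizedAdjacency G W) {f : V → ℂ} {x : ℝ}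
    (hf : hermitianAdjacency W *ᵥ f = (x : ℂ) • f) (d : G.Dart → ℂ)
    (hd : d = (arcReversal G * (tailIncidence G W)ᴴ) *ᵥ f
      - (x : ℂ) • ((tailIncidence G W)ᴴ *ᵥ f)) :
    star d ⬝ᵥ d = ((1 - x ^ 2 : ℝ) : ℂ) * (star f ⬝ᵥ f) := by
  have hN := tailIncidence_mul_conjTranspose G hW
  have hNR := tailIncidence_mul_arcReversal_mul G hW
  have h1 : tailIncidence G W *ᵥ d = 0 := by
    rw [hd, Matrix.mulVec_sub, Matrix.mulVec_smul, Matrix.mulVec_mulVec, Matrix.mulVec_mulVec,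
      hN, hNR, hf, Matrix.one_mulVec, sub_self]
  have h2 : (tailIncidence G W * arcReversal G) *ᵥ d = ((1 - x ^ 2 : ℝ) : ℂ) • f := by
    rw [hd, Matrix.mulVec_sub, Matrix.mulVec_smul, Matrix.mulVec_mulVec, Matrix.mulVec_mulVec,
      Matrix.mul_assoc, ← Matrix.mul_assoc (arcReversal G), arcReversal_mul_self, Matrix.one_mul,
      hN, Matrix.mul_assoc, hNR, hf, Matrix.one_mulVec, smul_smul]
    push_cast
    module
  conv_lhs => enter [1]; rw [hd]
  rw [star_sub, star_smul, sub_dotProduct, smul_dotProduct, Matrix.star_mulVec,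
    Matrix.star_mulVec, ← Matrix.dotProduct_mulVec, ← Matrix.dotProduct_mulVec,
    Matrix.conjTranspose_mul, Matrix.conjTranspose_conjTranspose, conjTranspose_arcReversal, h1, h2]
  simp

open ComplexOrder in
theorem sq_le_one_of_hermitianAdjacency_mulVec {W : Matrix V V ℂ}
    (hW : IsNormalizedAdjacency G W) {f : V → ℂ} {x : ℝ}
    (hf : hermitianAdjacency W *ᵥ f = (x : ℂ) • f) (hf0 : f ≠ 0) : x ^ 2 ≤ 1 := by
  have h := star_dotProduct_lift_sub G hW hf _ rfl
  have hpos : 0 < (star f ⬝ᵥ f) := Matrix.dotProduct_star_self_pos_iff.mpr hf0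
  set d := (arcReversal G * (tailIncidence G W)ᴴ) *ᵥ f
      - (x : ℂ) • ((tailIncidence G W)ᴴ *ᵥ f)
  have hnn : 0 ≤ star d ⬝ᵥ d := dotProduct_star_self_nonneg d
  rw [h] at hnn
  have hre := (Complex.le_def.mp hnn).1
  rw [Complex.re_ofReal_mul, Complex.zero_re] at hre
  have := nonneg_of_mul_nonneg_left hre (Complex.pos_iff.mp hpos).1
  linarith

/-- The eigenvector of the walk with eigenvalue `z ≠ ±1` that an eigenvector `f` of `H` with
eigenvalue `(z + z⁻¹) / 2` gives. -/
theorem transition_mulVec_lift {W : Matrix V V ℂ}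
    (hW : IsNormalizedAdjacency G W) {f : V → ℂ} {z : ℂ} (hz : z ≠ 0) (hz' : z - z⁻¹ ≠ 0)
    (hf : hermitianAdjacency W *ᵥ f = ((z + z⁻¹) / 2) • f) (p : G.Dart → ℂ)
    (hp : p = (z - z⁻¹)⁻¹ • ((arcReversal G * (tailIncidence G W)ᴴ) *ᵥ f
      - z⁻¹ • ((tailIncidence G W)ᴴ *ᵥ f))) :
    transition G W *ᵥ p = z • p ∧ tailIncidence G W *ᵥ p = (1 / 2 : ℂ) • f := by
  constructor
  · rw [hp, Matrix.mulVec_smul, Matrix.mulVec_sub, Matrix.mulVec_smul, Matrix.mulVec_mulVec,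
      Matrix.mulVec_mulVec, transition_mul_conjTranspose_tailIncidence G hW,
      transition_mul_arcReversal_mul G hW, Matrix.sub_mulVec, Matrix.smul_mulVec,
      ← Matrix.mulVec_mulVec, hf, Matrix.mulVec_smul, smul_comm z]
    congr 1
    ext i
    simp only [Pi.sub_apply, Pi.smul_apply, smul_eq_mul]
    field_simp
    ring
  · rw [hp, Matrix.mulVec_smul, Matrix.mulVec_sub, Matrix.mulVec_smul, Matrix.mulVec_mulVec,
      Matrix.mulVec_mulVec, tailIncidence_mul_arcReversal_mul G hW,
      tailIncidence_mul_conjTranspose G hW, hf, Matrix.one_mulVec, ← sub_smul, smul_smul]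
    congr 1
    linear_combination (1 / 2) * inv_mul_cancel₀ hz'

open ComplexOrder in
/-- If `H f = x f` with `x = cos θ`, then `N* f` is the sum of eigenvectors `p` and `q` of the walk
with the eigenvalues `exp (± i θ)`, and `N` maps both to `f / 2`. For `x = ±1` the two eigenvalues
coincide and `p = q`. -/
theorem exists_lift_eigenvectors {W : Matrix V V ℂ}
    (hW : IsNormalizedAdjacency G W) {f : V → ℂ} {x : ℝ}
    (hf : hermitianAdjacency W *ᵥ f = (x : ℂ) • f) (hx : x ^ 2 ≤ 1) :
    ∃ p q : G.Dart → ℂ,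
      transition G W *ᵥ p = (Circle.exp (Real.arccos x) : ℂ) • p ∧
      transition G W *ᵥ q = ((Circle.exp (Real.arccos x))⁻¹ : ℂ) • q ∧
      tailIncidence G W *ᵥ p = (1 / 2 : ℂ) • f ∧
      tailIncidence G W *ᵥ q = (1 / 2 : ℂ) • f ∧
      (tailIncidence G W)ᴴ *ᵥ f = p + q := by
  obtain ⟨hx1, hx2⟩ := abs_le.mp ((sq_le_one_iff_abs_le_one x).mp hx)
  set z : ℂ := (Circle.exp (Real.arccos x) : ℂ) with hzdef
  have hz : z ≠ 0 := Circle.coe_ne_zero _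
  have hzx : (x : ℂ) = (z + z⁻¹) / 2 := by
    have h1 : z⁻¹ = Complex.exp (-(Real.arccos x) * Complex.I) := by
      rw [hzdef, Circle.coe_exp, ← Complex.exp_neg, neg_mul]
    rw [h1, hzdef, Circle.coe_exp]
    conv_lhs => rw [← Real.cos_arccos hx1 hx2, Complex.ofReal_cos, Complex.cos]
  by_cases hz' : z - z⁻¹ = 0
  -- here `x = z = ±1`, so `R N* f = x N* f` and `N* f` is itself an eigenvector of the walk
  · have hzz : z⁻¹ = z := (sub_eq_zero.mp hz').symm
    have hxz : (x : ℂ) = z := by rw [hzx, hzz]; ring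
    have hx0 : 1 - x ^ 2 = 0 := by
      have : (x : ℂ) * x = 1 := by
        rw [hxz]; nth_rewrite 1 [← hzz]; exact inv_mul_cancel₀ hz
      have h2 : x * x = 1 := by exact_mod_cast this
      linarith
    have hd := star_dotProduct_lift_sub G hW hf _ rfl
    rw [hx0, Complex.ofReal_zero, zero_mul, dotProduct_star_self_eq_zero, sub_eq_zero] at hd
    have hU : transition G W *ᵥ ((1 / 2 : ℂ) • ((tailIncidence G W)ᴴ *ᵥ f))
        = z • ((1 / 2 : ℂ) • ((tailIncidence G W)ᴴ *ᵥ f)) := by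
      rw [Matrix.mulVec_smul, Matrix.mulVec_mulVec,
        transition_mul_conjTranspose_tailIncidence G hW, hd, hxz, smul_comm]
    have hN : tailIncidence G W *ᵥ ((1 / 2 : ℂ) • ((tailIncidence G W)ᴴ *ᵥ f))
        = (1 / 2 : ℂ) • f := by
      rw [Matrix.mulVec_smul, Matrix.mulVec_mulVec, tailIncidence_mul_conjTranspose G hW,
        Matrix.one_mulVec]
    refine ⟨_, _, hU, by rw [hzz]; exact hU, hN, hN, ?_⟩
    module
  · rw [hzx] at hf
    obtain ⟨hp1, hp2⟩ := transition_mulVec_lift G hW hz hz' hf _ rfl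
    have hzi : z⁻¹ - z⁻¹⁻¹ ≠ 0 := by
      rw [inv_inv, ← neg_sub]; exact neg_ne_zero.mpr hz'
    obtain ⟨hq1, hq2⟩ := transition_mulVec_lift G hW (inv_ne_zero hz) hzi
      (by rw [inv_inv, add_comm]; exact hf) _ rfl
    refine ⟨_, _, hp1, hq1, hp2, hq2, ?_⟩
    ext i
    have h3 : (z⁻¹ - z)⁻¹ = -(z - z⁻¹)⁻¹ := by rw [← neg_sub, inv_neg]
    simp only [Pi.add_apply, Pi.sub_apply, Pi.smul_apply, smul_eq_mul, inv_inv, h3]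
    generalize ((tailIncidence G W)ᴴ *ᵥ f) i = A
    generalize ((arcReversal G * (tailIncidence G W)ᴴ) *ᵥ f) i = B
    linear_combination (-A) * inv_mul_cancel₀ hz'

end Walk

/-! ### Spectral decomposition of the vertex vectors -/

theorem isHermitian_hermitianAdjacency {V : Type*} (W : Matrix V V ℂ) :
    (hermitianAdjacency W).IsHermitian := by
  ext u v
  simp [hermitianAdjacency, mul_comm]

section Spectral

variable {V : Type*} [Fintype V] [DecidableEq V] {H : Matrix V V ℂ}

theorem mem_eigenvalueSupport {l : ℝ} {a : V} :
    l ∈ eigenvalueSupport H a ↔ eigenProj H l a ≠ 0 := by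
  simp [eigenvalueSupport]

theorem mulVec_eigenProj (H : Matrix V V ℂ) (l : ℝ) (a : V) :
    H *ᵥ (eigenProj H l a).ofLp = (l : ℂ) • (eigenProj H l a).ofLp := by
  have h : eigenProj H l a ∈ Module.End.eigenspace (Matrix.toEuclideanLin H) (l : ℂ) :=
    Submodule.starProjection_apply_mem _ _
  rw [Module.End.mem_eigenspace_iff] at h
  simpa using congrArg WithLp.ofLp h

theorem inner_eigenProj_single (H : Matrix V V ℂ) (l : ℝ) (a b : V) :
    inner ℂ (eigenProj H l b) (EuclideanSpace.single a 1) =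
      inner ℂ (eigenProj H l b) (eigenProj H l a) := by
  have h : eigenProj H l b ∈ Module.End.eigenspace (Matrix.toEuclideanLin H) (l : ℂ) :=
    Submodule.starProjection_apply_mem _ _
  conv_lhs => rw [← Submodule.starProjection_eq_self_iff.mpr h]
  rw [Submodule.inner_starProjection_left_eq_right]
  rfl

/-- The spectral decomposition of the characteristic vector of a vertex. -/
theorem sum_eigenProj (hH : H.IsHermitian) (a : V) :
    ∑ l ∈ eigenvalueSupport H a, eigenProj H l a = EuclideanSpace.single a 1 := by
  classical
  have hT : (Matrix.toEuclideanLin H).IsSymmetric := Matrix.isSymmetric_toEuclideanLin_iff.mpr hH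
  have htop : (⨆ μ : Module.End.Eigenvalues (Matrix.toEuclideanLin H),
      Module.End.eigenspace (Matrix.toEuclideanLin H) (μ : ℂ)) = ⊤ :=
    Submodule.orthogonal_eq_bot_iff.mp hT.orthogonalComplement_iSup_eigenspaces_eq_bot'
  have hsum := hT.orthogonalFamily_eigenspaces'.sum_projection_of_mem_iSup
    (EuclideanSpace.single a (1 : ℂ)) (htop ▸ Submodule.mem_top)
  rw [← hsum]
  have hre : ∀ μ : Module.End.Eigenvalues (Matrix.toEuclideanLin H),
      (((μ : ℂ).re : ℝ) : ℂ) = μ := fun μ =>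
    Complex.conj_eq_iff_re.mp (hT.conj_eigenvalue_eq_self μ.2)
  have hproj : ∀ μ : Module.End.Eigenvalues (Matrix.toEuclideanLin H),
      eigenProj H (μ : ℂ).re a = (Module.End.eigenspace (Matrix.toEuclideanLin H)
        (μ : ℂ)).starProjection (EuclideanSpace.single a 1) := fun μ => by
    simp only [eigenProj, hre]
  symm
  refine Finset.sum_bij_ne_zero (fun μ _ _ => (μ : ℂ).re) ?_ ?_ ?_ ?_
  · intro μ _ hμ
    rw [mem_eigenvalueSupport, hproj]
    exact hμ
  · intro μ _ _ ν _ _ h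
    exact Subtype.ext ((hre μ).symm.trans ((congrArg Complex.ofReal h).trans (hre ν)))
  · intro l hl hl0
    have hl' : Module.End.HasEigenvalue (Matrix.toEuclideanLin H) (l : ℂ) := by
      intro hbot
      have hb : Module.End.eigenspace (Matrix.toEuclideanLin H) (l : ℂ) = ⊥ := hbot
      exact hl0 (by simp [eigenProj, hb])
    exact ⟨⟨(l : ℂ), hl'⟩, Finset.mem_univ _, hl0, Complex.ofReal_re l⟩
  · intro μ _ _
    exact (hproj μ).symm

theorem sum_norm_sq_eigenProj (hH : H.IsHermitian) (a : V) :
    ∑ l ∈ eigenvalueSupport H a, ‖eigenProj H l a‖ ^ 2 = 1 := by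
  have h : inner ℂ (∑ l ∈ eigenvalueSupport H a, eigenProj H l a)
      (EuclideanSpace.single a (1 : ℂ)) = (1 : ℂ) := by
    rw [sum_eigenProj hH]
    simp
  rw [sum_inner] at h
  simp only [inner_eigenProj_single, inner_self_eq_norm_sq_to_K] at h
  apply Complex.ofReal_injective
  push_cast
  exact h

/-- If the components of `e_a` and `e_b` differ by phases on the eigenvalue support of `a`, then
both vertices have the same eigenvalue support: the components over the support of `a` already
exhaust the norm of `e_b`. -/
theorem eigenvalueSupport_eq_of_phases (hH : H.IsHermitian) {a b : V} {c : ℝ → Circle}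
    (hc : ∀ l ∈ eigenvalueSupport H a, eigenProj H l a = (c l : ℂ) • eigenProj H l b) :
    eigenvalueSupport H b = eigenvalueSupport H a := by
  have hsub : eigenvalueSupport H a ⊆ eigenvalueSupport H b := fun l hl => by
    rw [mem_eigenvalueSupport]
    intro h0
    exact mem_eigenvalueSupport.mp hl (by rw [hc l hl, h0, smul_zero])
  have h1 : ∑ l ∈ eigenvalueSupport H a, ‖eigenProj H l b‖ ^ 2 = 1 := by
    rw [← sum_norm_sq_eigenProj hH a]
    refine Finset.sum_congr rfl fun l hl => ?_
    rw [hc l hl, norm_smul, Circle.norm_coe, one_mul]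
  refine (Finset.Subset.antisymm hsub fun l hl => ?_).symm
  by_contra hla
  have h2 := sum_norm_sq_eigenProj hH b
  rw [← Finset.sum_sdiff hsub, h1, add_eq_right] at h2
  have h3 := (Finset.sum_eq_zero_iff_of_nonneg fun _ _ => sq_nonneg _).mp h2 l
    (Finset.mem_sdiff.mpr ⟨hl, hla⟩)
  exact mem_eigenvalueSupport.mp hl (norm_eq_zero.mp (pow_eq_zero_iff two_ne_zero |>.mp h3))

end Spectral

/-! ### Reduction of pretty good state transfer to approximation on the circle -/

section Transfer

theorem zpow_mulVec_of_mulVec_eq_smul {ι : Type*} [Fintype ι] [DecidableEq ι] {U : Matrix ι ι ℂ}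
    (hU : IsUnit U.det) {z : ℂ} (hz : z ≠ 0) {w : ι → ℂ} (hw : U *ᵥ w = z • w) (t : ℤ) :
    (U ^ t) *ᵥ w = z ^ t • w := by
  have hinv : U⁻¹ *ᵥ w = z⁻¹ • w := by
    have : U⁻¹ *ᵥ (U *ᵥ w) = w := by
      rw [Matrix.mulVec_mulVec, Matrix.nonsing_inv_mul _ hU, Matrix.one_mulVec]
    rw [hw, Matrix.mulVec_smul] at this
    rw [← this, smul_smul, inv_mul_cancel₀ hz, one_smul, this]
  induction t using Int.induction_on with
  | zero => simp
  | succ n ih =>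
    rw [Matrix.zpow_add_one hU, ← Matrix.mulVec_mulVec, hw, Matrix.mulVec_smul, ih, smul_smul,
      zpow_add_one₀ hz, mul_comm]
  | pred n ih =>
    rw [Matrix.zpow_sub_one hU, ← Matrix.mulVec_mulVec, hinv, Matrix.mulVec_smul, ih, smul_smul,
      zpow_sub_one₀ hz, mul_comm]

/-- An eigenvector of a unitary matrix for the unimodular eigenvalue `z` is a left eigenvector for
the same eigenvalue, after conjugation. -/
theorem star_dotProduct_zpow_mulVec {ι : Type*} [Fintype ι] [DecidableEq ι] {U : Matrix ι ι ℂ}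
    (hU : Uᴴ * U = 1) {z : Circle} {w : ι → ℂ} (hw : U *ᵥ w = (z : ℂ) • w) (t : ℤ) (x : ι → ℂ) :
    star w ⬝ᵥ ((U ^ t) *ᵥ x) = (z : ℂ) ^ t * (star w ⬝ᵥ x) := by
  have hdet : IsUnit U.det := Matrix.isUnit_det_of_left_inverse hU
  have hinv : Uᴴ = U⁻¹ := (Matrix.inv_eq_left_inv hU).symm
  have h : (U ^ t)ᴴ *ᵥ w = (z : ℂ) ^ (-t) • w := by
    rw [Matrix.conjTranspose_zpow, hinv, Matrix.inv_zpow' hdet]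
    exact zpow_mulVec_of_mulVec_eq_smul hdet (Circle.coe_ne_zero z) hw _
  have h' : star ((z : ℂ) ^ (-t)) = (z : ℂ) ^ t := by
    rw [← Circle.coe_zpow, ← Circle.coe_zpow, zpow_neg, Circle.coe_inv_eq_conj]
    exact star_star _
  rw [Matrix.dotProduct_mulVec, ← star_star (star w ᵥ* U ^ t), Matrix.star_vecMul, star_star, h,
    star_smul, h', smul_dotProduct, smul_eq_mul]

theorem norm_star_dotProduct_le {ι : Type*} [Fintype ι] (w x : ι → ℂ) :
    ‖star w ⬝ᵥ x‖ ≤ ‖WithLp.toLp 2 w‖ * ‖WithLp.toLp 2 x‖ := by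
  have := norm_inner_le_norm (𝕜 := ℂ) (WithLp.toLp 2 w) (WithLp.toLp 2 x)
  rwa [EuclideanSpace.inner_toLp_toLp, dotProduct_comm] at this

/-- Under a unitary matrix, pretty good state transfer can be reversed. -/
theorem prettyGoodStateTransfer_symm {ι : Type*} [Fintype ι] [DecidableEq ι] {U : Matrix ι ι ℂ}
    (hU : Uᴴ * U = 1) {x y : ι → ℂ} (h : PrettyGoodStateTransfer U x y) :
    PrettyGoodStateTransfer U y x := by
  have hdet : IsUnit U.det := Matrix.isUnit_det_of_left_inverse hU
  have hinv : Uᴴ = U⁻¹ := (Matrix.inv_eq_left_inv hU).symm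
  have hnorm : ∀ (t : ℤ) (v : ι → ℂ),
      ‖WithLp.toLp 2 ((U ^ t) *ᵥ v)‖ = ‖WithLp.toLp 2 v‖ := by
    intro t v
    have h1 : (U ^ t)ᴴ * U ^ t = 1 := by
      rw [Matrix.conjTranspose_zpow, hinv, Matrix.inv_zpow' hdet,
        Matrix.zpow_neg_mul_zpow_self _ hdet]
    have h2 : inner ℂ (WithLp.toLp 2 ((U ^ t) *ᵥ v)) (WithLp.toLp 2 ((U ^ t) *ᵥ v))
        = inner ℂ (WithLp.toLp 2 v) (WithLp.toLp 2 v) := by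
      rw [EuclideanSpace.inner_toLp_toLp, EuclideanSpace.inner_toLp_toLp, dotProduct_comm,
        Matrix.star_mulVec, ← Matrix.dotProduct_mulVec, Matrix.mulVec_mulVec, h1,
        Matrix.one_mulVec, dotProduct_comm]
    rw [@norm_eq_sqrt_re_inner ℂ, @norm_eq_sqrt_re_inner ℂ, h2]
  obtain ⟨γ, hγ, h⟩ := h
  have hγ0 : γ ≠ 0 := fun h0 => by simp [h0] at hγ
  refine ⟨γ⁻¹, by simp [hγ], fun ε hε => ?_⟩
  obtain ⟨t, ht⟩ := h ε hε
  refine ⟨-t, ?_⟩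
  have key : (U ^ (-t)) *ᵥ y - γ⁻¹ • x
      = (-γ⁻¹) • ((U ^ (-t)) *ᵥ ((U ^ t) *ᵥ x - γ • y)) := by
    rw [Matrix.mulVec_sub, Matrix.mulVec_mulVec, Matrix.zpow_neg_mul_zpow_self _ hdet,
      Matrix.one_mulVec, Matrix.mulVec_smul, smul_sub, smul_smul, neg_mul, inv_mul_cancel₀ hγ0]
    module
  rw [key, WithLp.toLp_smul, norm_smul, norm_neg, norm_inv, hγ, inv_one, one_mul, hnorm]
  exact ht

variable {V : Type*} [Fintype V] [DecidableEq V] (G : SimpleGraph V) [DecidableRel G.Adj]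

/-- Suppose the components of `e_a` and `e_b` in the eigenspaces of `H` differ by the phases `c`.
In terms of the eigenvectors of the walk over these components, state transfer from `a` to `b`
says that the numbers `exp (± i t arccos l) c l` are nearly equal for a suitable `t`. -/
theorem prettyGoodStateTransfer_iff_exists_phase {W : Matrix V V ℂ}
    (hW : IsNormalizedAdjacency G W) {a b : V} {c : ℝ → Circle}
    (hc : ∀ l ∈ eigenvalueSupport (hermitianAdjacency W) a,
      eigenProj (hermitianAdjacency W) l a = (c l : ℂ) • eigenProj (hermitianAdjacency W) l b) :
    PrettyGoodStateTransfer (transition G W) (vertexState G W a) (vertexState G W b) ↔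
      ∃ γ : Circle, ∀ ε : ℝ, 0 < ε → ∃ t : ℤ,
        ∀ l ∈ eigenvalueSupport (hermitianAdjacency W) a,
          ‖(Circle.exp (Real.arccos l) : ℂ) ^ t * c l - γ‖ < ε ∧
          ‖((Circle.exp (Real.arccos l))⁻¹ : ℂ) ^ t * c l - γ‖ < ε := by
  have hherm := isHermitian_hermitianAdjacency W
  have hsupp := eigenvalueSupport_eq_of_phases hherm hc
  have hsa := congrArg WithLp.ofLp (sum_eigenProj hherm a)
  have hsb := congrArg WithLp.ofLp (sum_eigenProj hherm b)
  rw [hsupp] at hsb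
  set H := hermitianAdjacency W with hHdef
  set Λ := eigenvalueSupport H a
  set U := transition G W with hUdef
  set N := tailIncidence G W
  let f : ℝ → V → ℂ := fun l => (eigenProj H l b).ofLp
  have hf0 : ∀ l ∈ Λ, eigenProj H l b ≠ 0 := fun l hl =>
    mem_eigenvalueSupport.mp (hsupp ▸ hl)
  have hf : ∀ l, H *ᵥ f l = (l : ℂ) • f l := fun l => mulVec_eigenProj H l b
  have hUU : Uᴴ * U = 1 := conjTranspose_transition_mul_self G hW
  have hdet : IsUnit U.det := Matrix.isUnit_det_of_left_inverse hUU
  have hlift : ∀ l : Λ, ∃ p q : G.Dart → ℂ,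
      U *ᵥ p = (Circle.exp (Real.arccos l) : ℂ) • p ∧
      U *ᵥ q = ((Circle.exp (Real.arccos l))⁻¹ : ℂ) • q ∧
      N *ᵥ p = (1 / 2 : ℂ) • f l ∧ N *ᵥ q = (1 / 2 : ℂ) • f l ∧ Nᴴ *ᵥ f l = p + q := fun l =>
    exists_lift_eigenvectors G hW (hf l) (sq_le_one_of_hermitianAdjacency_mulVec G hW (hf l)
      fun h0 => hf0 l l.2 (by ext i; exact congrFun h0 i))
  choose p q hp hq hNp hNq hpq using hlift
  have heb : (Pi.single b 1 : V → ℂ) = ∑ l : Λ, f l := by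
    rw [Finset.sum_coe_sort Λ f]
    simpa [f] using hsb.symm
  have hea : (Pi.single a 1 : V → ℂ) = ∑ l : Λ, (c l : ℂ) • f l := by
    rw [Finset.sum_coe_sort Λ fun l => (c l : ℂ) • f l]
    rw [Finset.sum_congr rfl hc] at hsa
    simpa [f] using hsa.symm
  have hvb : vertexState G W b = ∑ l : Λ, (p l + q l) := by
    rw [vertexState, heb, Matrix.mulVec_sum]
    exact Finset.sum_congr rfl fun l _ => hpq l
  have hva : vertexState G W a = ∑ l : Λ, (c l : ℂ) • (p l + q l) := by
    rw [vertexState, hea, Matrix.mulVec_sum]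
    refine Finset.sum_congr rfl fun l _ => ?_
    rw [Matrix.mulVec_smul]
    exact congrArg _ (hpq l)
  constructor
  · rintro ⟨γ, hγ, h⟩
    -- pairing with one eigenvector of the walk isolates one phase, up to a fixed nonzero factor
    have hpair : ∀ (l : Λ) (z : Circle) (w : G.Dart → ℂ), U *ᵥ w = (z : ℂ) • w →
        N *ᵥ w = (1 / 2 : ℂ) • f l → ∃ C : ℝ, 0 ≤ C ∧ ∀ t : ℤ,
          ‖(z : ℂ) ^ t * c l - γ‖ ≤ C *
            ‖WithLp.toLp 2 ((U ^ t) *ᵥ vertexState G W a - γ • vertexState G W b)‖ := by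
      intro l z w hUw hNw
      have hfe : ∀ v : V, star w ⬝ᵥ vertexState G W v
          = (1 / 2 : ℂ) * inner ℂ (eigenProj H l b) (eigenProj H l v) := by
        intro v
        rw [vertexState, Matrix.dotProduct_mulVec, ← Matrix.star_mulVec, hNw, star_smul,
          smul_dotProduct, ← inner_eigenProj_single, EuclideanSpace.inner_eq_star_dotProduct,
          dotProduct_comm]
        simp [f]
      set s : ℂ := inner ℂ (eigenProj H l b) (eigenProj H l b) with hs
      have hs0 : s ≠ 0 := inner_self_ne_zero.mpr (hf0 l l.2)
      refine ⟨2 * ‖WithLp.toLp 2 w‖ / ‖s‖, by positivity, fun t => ?_⟩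
      have h1 : star w ⬝ᵥ ((U ^ t) *ᵥ vertexState G W a - γ • vertexState G W b)
          = (1 / 2 : ℂ) * s * ((z : ℂ) ^ t * c l - γ) := by
        rw [dotProduct_sub, dotProduct_smul, star_dotProduct_zpow_mulVec hUU hUw, hfe, hfe,
          hc l l.2, inner_smul_right, smul_eq_mul]
        ring
      have h2 := norm_star_dotProduct_le w
        ((U ^ t) *ᵥ vertexState G W a - γ • vertexState G W b)
      rw [h1, norm_mul, norm_mul] at h2
      have h3 : ‖(1 / 2 : ℂ)‖ = 1 / 2 := by norm_num
      rw [h3] at h2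
      have hs1 : 0 < ‖s‖ := norm_pos_iff.mpr hs0
      rw [div_mul_eq_mul_div, le_div_iff₀ hs1]
      linarith
    choose C₁ hC₁ hC₁' using fun l : Λ => hpair l _ (p l) (hp l) (hNp l)
    choose C₂ hC₂ hC₂' using fun l : Λ =>
      hpair l (Circle.exp (Real.arccos l))⁻¹ (q l) (by rw [Circle.coe_inv]; exact hq l) (hNq l)
    set C : ℝ := ∑ l : Λ, (C₁ l + C₂ l) + 1
    have hCpos : 0 < C := by
      have : 0 ≤ ∑ l : Λ, (C₁ l + C₂ l) :=
        Finset.sum_nonneg fun l _ => add_nonneg (hC₁ l) (hC₂ l)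
      positivity
    have hCle : ∀ l : Λ, C₁ l + C₂ l ≤ C := fun l => by
      have := Finset.single_le_sum (f := fun l : Λ => C₁ l + C₂ l)
        (fun l _ => add_nonneg (hC₁ l) (hC₂ l)) (Finset.mem_univ l)
      linarith
    refine ⟨⟨γ, mem_sphere_zero_iff_norm.mpr hγ⟩, fun ε hε => ?_⟩
    obtain ⟨t, ht⟩ := h (ε / C) (div_pos hε hCpos)
    rw [lt_div_iff₀' hCpos] at ht
    refine ⟨t, fun l hl => ⟨?_, ?_⟩⟩
    · refine ((hC₁' ⟨l, hl⟩ t).trans ?_).trans_lt ht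
      gcongr
      linarith [hCle ⟨l, hl⟩, hC₂ ⟨l, hl⟩]
    · have := hC₂' ⟨l, hl⟩ t
      rw [Circle.coe_inv] at this
      refine (this.trans ?_).trans_lt ht
      gcongr
      linarith [hCle ⟨l, hl⟩, hC₁ ⟨l, hl⟩]
  · rintro ⟨γ, h⟩
    refine ⟨γ, γ.norm_coe, fun ε hε => ?_⟩
    set C : ℝ := ∑ l : Λ, (‖WithLp.toLp 2 (p l)‖ + ‖WithLp.toLp 2 (q l)‖)
    have hC : 0 ≤ C := Finset.sum_nonneg fun l _ => by positivity
    obtain ⟨t, ht⟩ := h (ε / (C + 1)) (by positivity)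
    refine ⟨t, ?_⟩
    have hdecomp : (U ^ t) *ᵥ vertexState G W a - (γ : ℂ) • vertexState G W b =
        ∑ l : Λ, (((Circle.exp (Real.arccos l) : ℂ) ^ t * c l - γ) • p l
          + (((Circle.exp (Real.arccos l))⁻¹ : ℂ) ^ t * c l - γ) • q l) := by
      rw [hva, hvb, Matrix.mulVec_sum, Finset.smul_sum, ← Finset.sum_sub_distrib]
      refine Finset.sum_congr rfl fun l _ => ?_
      rw [Matrix.mulVec_smul, Matrix.mulVec_add,
        zpow_mulVec_of_mulVec_eq_smul hdet (Circle.coe_ne_zero _) (hp l),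
        zpow_mulVec_of_mulVec_eq_smul hdet (inv_ne_zero (Circle.coe_ne_zero _)) (hq l)]
      module
    have hle : ‖WithLp.toLp 2 ((U ^ t) *ᵥ vertexState G W a - (γ : ℂ) • vertexState G W b)‖
        ≤ ε / (C + 1) * C := by
      rw [hdecomp, WithLp.toLp_sum, Finset.mul_sum]
      refine norm_sum_le_of_le _ fun l _ => ?_
      rw [WithLp.toLp_add, WithLp.toLp_smul, WithLp.toLp_smul]
      refine (norm_add_le _ _).trans ?_
      rw [norm_smul, norm_smul, mul_add]
      have := ht l l.2
      gcongr
      · exact this.1.le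
      · exact this.2.le
    refine hle.trans_lt ?_
    rw [div_mul_eq_mul_div, div_lt_iff₀ (by positivity)]
    linarith

end Transfer

/-! ### From characters to the arithmetic condition -/

theorem torusChar_exp {ι : Type*} [Fintype ι] (n : ι → ℤ) (θ : ι → ℝ) :
    torusChar n (fun j => Circle.exp (θ j)) = Circle.exp (∑ j, (n j : ℝ) * θ j) := by
  classical
  rw [torusChar_apply]
  refine Finset.induction_on (motive := fun s =>
    ∏ j ∈ s, Circle.exp (θ j) ^ n j = Circle.exp (∑ j ∈ s, (n j : ℝ) * θ j))
    Finset.univ (by simp) fun i s hi ih => ?_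
  rw [Finset.prod_insert hi, Finset.sum_insert hi, ih, Circle.exp_add, Circle.exp_intCast_mul]

theorem circle_exp_two_pi_mul_div_eq_one_iff {m : ℕ} (hm : 0 < m) (s : ℤ) :
    Circle.exp (2 * Real.pi * s / m) = 1 ↔ s ≡ 0 [ZMOD m] := by
  have hm' : (m : ℝ) ≠ 0 := by exact_mod_cast hm.ne'
  rw [Circle.exp_eq_one, Int.modEq_zero_iff_dvd]
  constructor
  · rintro ⟨k, hk⟩
    refine ⟨k, ?_⟩
    have : 2 * Real.pi * (s - m * k) = 0 := by
      field_simp at hk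
      linear_combination (2 * Real.pi) * hk
    have h2 := (mul_eq_zero.mp this).resolve_left Real.two_pi_pos.ne'
    exact_mod_cast sub_eq_zero.mp h2
  · rintro ⟨k, rfl⟩
    exact ⟨k, by push_cast; field_simp⟩

/-- For phases `exp (2 π i κ / m)`, approximation by powers of the conjugate pairs
`exp (± i arccos x)` is an arithmetic condition on the exponents of characters. -/
theorem exists_phase_iff_forall_int {m : ℕ} (hm : 0 < m) (Λ : Finset ℝ) (κ : ℝ → ℤ) :
    (∃ γ : Circle, ∀ ε : ℝ, 0 < ε → ∃ t : ℤ, ∀ x ∈ Λ,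
        ‖(Circle.exp (Real.arccos x) : ℂ) ^ t * Circle.exp (2 * Real.pi * κ x / m) - γ‖ < ε ∧
        ‖((Circle.exp (Real.arccos x))⁻¹ : ℂ) ^ t * Circle.exp (2 * Real.pi * κ x / m) - γ‖ < ε) ↔
      ∀ l l' : ℝ → ℤ,
        (∑ x ∈ Λ, ((l x : ℝ) - l' x) * Real.arccos x ≡ 0 [PMOD (2 * Real.pi)]) →
        ∑ x ∈ Λ, (l x + l' x) = 0 → ∑ x ∈ Λ, κ x * (l x + l' x) ≡ 0 [ZMOD m] := by
  let θ : Λ ⊕ Λ → ℝ := Sum.elim (fun x => Real.arccos x) (fun x => -Real.arccos x)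
  let φ : Λ ⊕ Λ → ℝ := Sum.elim (fun x => 2 * Real.pi * κ x / m) (fun x => 2 * Real.pi * κ x / m)
  have hK := exists_zpow_mul_near_const_iff (fun j => Circle.exp (θ j))
    (fun j => Circle.exp (φ j))
  have hleft : ∀ (γ : Circle) (ε : ℝ) (t : ℤ),
      (∀ j, ‖(Circle.exp (θ j) : ℂ) ^ t * Circle.exp (φ j) - γ‖ < ε) ↔ ∀ x ∈ Λ,
        ‖(Circle.exp (Real.arccos x) : ℂ) ^ t * Circle.exp (2 * Real.pi * κ x / m) - γ‖ < ε ∧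
        ‖((Circle.exp (Real.arccos x))⁻¹ : ℂ) ^ t * Circle.exp (2 * Real.pi * κ x / m) - γ‖
          < ε := by
    intro γ ε t
    simp only [Sum.forall, θ, φ, Sum.elim_inl, Sum.elim_inr, Circle.exp_neg, Circle.coe_inv,
      Subtype.forall]
    exact ⟨fun h x hx => ⟨h.1 x hx, h.2 x hx⟩,
      fun h => ⟨fun x hx => (h x hx).1, fun x hx => (h x hx).2⟩⟩
  simp only [hleft] at hK
  rw [hK]
  have hchar : ∀ (n : Λ ⊕ Λ → ℤ) (l l' : ℝ → ℤ), (∀ x : Λ, n (.inl x) = l x) →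
      (∀ x : Λ, n (.inr x) = l' x) →
      ((torusChar n (fun j => Circle.exp (θ j)) = 1 → ∑ j, n j = 0 →
        torusChar n (fun j => Circle.exp (φ j)) = 1) ↔
      ((∑ x ∈ Λ, ((l x : ℝ) - l' x) * Real.arccos x ≡ 0 [PMOD (2 * Real.pi)]) →
        ∑ x ∈ Λ, (l x + l' x) = 0 → ∑ x ∈ Λ, κ x * (l x + l' x) ≡ 0 [ZMOD m])) := by
    intro n l l' hl hl'
    have h1 : ∑ j, (n j : ℝ) * θ j = ∑ x ∈ Λ, ((l x : ℝ) - l' x) * Real.arccos x := by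
      rw [Fintype.sum_sum_type, ← Finset.sum_add_distrib, ← Finset.sum_coe_sort Λ]
      refine Finset.sum_congr rfl fun x _ => ?_
      simp only [θ, Sum.elim_inl, Sum.elim_inr, hl, hl']
      ring
    have h2 : ∑ j, n j = ∑ x ∈ Λ, (l x + l' x) := by
      rw [Fintype.sum_sum_type, ← Finset.sum_add_distrib, ← Finset.sum_coe_sort Λ]
      simp only [hl, hl']
    have h3 : ∑ j, (n j : ℝ) * φ j
        = 2 * Real.pi * ((∑ x ∈ Λ, κ x * (l x + l' x) : ℤ) : ℝ) / m := by
      push_cast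
      rw [Fintype.sum_sum_type, ← Finset.sum_add_distrib, ← Finset.sum_coe_sort Λ,
        Finset.mul_sum, Finset.sum_div]
      refine Finset.sum_congr rfl fun x _ => ?_
      simp only [φ, Sum.elim_inl, Sum.elim_inr, hl, hl']
      ring
    rw [torusChar_exp, torusChar_exp, h1, h2, h3, circle_exp_two_pi_mul_div_eq_one_iff hm,
      ← Circle.exp_zero, Circle.exp_inj]
  constructor
  · intro h l l'
    exact (hchar (Sum.elim (fun x => l x) (fun x => l' x)) l l' (fun _ => rfl)
      (fun _ => rfl)).mp (h _)
  · intro h n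
    classical
    exact (hchar n (fun x => if hx : x ∈ Λ then n (.inl ⟨x, hx⟩) else 0)
      (fun x => if hx : x ∈ Λ then n (.inr ⟨x, hx⟩) else 0) (fun x => by simp)
      (fun x => by simp)).mpr (h _ _)

theorem sum_eq_sum_sdiff_pm_one {M : Type*} [AddCommMonoid M] (Λ : Finset ℝ) (F : ℝ → M) :
    ∑ x ∈ Λ, F x = ∑ x ∈ Λ \ {1, -1}, F x
      + (if (1 : ℝ) ∈ Λ then F 1 else 0) + (if (-1 : ℝ) ∈ Λ then F (-1) else 0) := by
  have h1 : Λ \ {1, -1} = (Λ.erase 1).erase (-1) := by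
    ext x; simp; tauto
  have hne : (-1 : ℝ) ≠ 1 := by norm_num
  have h2 : ∀ (S : Finset ℝ) (y : ℝ), ∑ x ∈ S, F x
      = ∑ x ∈ S.erase y, F x + if y ∈ S then F y else 0 := by
    intro S y
    by_cases hy : y ∈ S
    · rw [if_pos hy, Finset.sum_erase_add S F hy]
    · rw [if_neg hy, Finset.erase_eq_of_notMem hy, add_zero]
  rw [h2 Λ 1, h2 (Λ.erase 1) (-1), h1]
  simp only [Finset.mem_erase, ne_eq, hne, not_false_eq_true, true_and]
  exact add_right_comm _ _ _

/-- The eigenvalues `1` and `-1` have angles `0` and `π`, for which the two conjugate exponents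
enter only through their sum (modulo `2 π`); so one integer is enough for each of them. -/
theorem forall_int_iff_separate_pm_one (m : ℕ) (Λ : Finset ℝ) (κ : ℝ → ℤ) :
    (∀ l l' : ℝ → ℤ,
        (∑ x ∈ Λ, ((l x : ℝ) - l' x) * Real.arccos x ≡ 0 [PMOD (2 * Real.pi)]) →
        ∑ x ∈ Λ, (l x + l' x) = 0 → ∑ x ∈ Λ, κ x * (l x + l' x) ≡ 0 [ZMOD m]) ↔
      ∀ (l l' : ℝ → ℤ) (l₁ l₂ : ℤ),
        (∑ x ∈ Λ \ {1, -1}, ((l x : ℝ) - l' x) * Real.arccos x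
            + (if (-1 : ℝ) ∈ Λ then (l₂ : ℝ) * Real.pi else 0) ≡ 0 [PMOD (2 * Real.pi)]) →
        ∑ x ∈ Λ \ {1, -1}, (l x + l' x) + (if (1 : ℝ) ∈ Λ then l₁ else 0)
            + (if (-1 : ℝ) ∈ Λ then l₂ else 0) = 0 →
        ∑ x ∈ Λ \ {1, -1}, κ x * (l x + l' x) + (if (1 : ℝ) ∈ Λ then κ 1 * l₁ else 0)
            + (if (-1 : ℝ) ∈ Λ then κ (-1) * l₂ else 0) ≡ 0 [ZMOD m] := by
  constructor
  · intro h l l' l₁ l₂ h1 h2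
    have hmem : ∀ x ∈ Λ \ {1, -1}, x ≠ 1 ∧ x ≠ -1 := fun x hx => by
      simp at hx; tauto
    have hne : (-1 : ℝ) ≠ 1 := by norm_num
    let L : ℝ → ℤ := fun x => if x = 1 then l₁ else if x = -1 then l₂ else l x
    let L' : ℝ → ℤ := fun x => if x = 1 then 0 else if x = -1 then 0 else l' x
    have hL : ∀ x ∈ Λ \ {1, -1}, L x = l x := fun x hx => by simp [L, hmem x hx]
    have hL' : ∀ x ∈ Λ \ {1, -1}, L' x = l' x := fun x hx => by simp [L', hmem x hx]
    have e1 : L 1 = l₁ := by simp [L]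
    have e2 : L (-1) = l₂ := by simp [L, hne]
    have e1' : L' 1 = 0 := by simp [L']
    have e2' : L' (-1) = 0 := by simp [L', hne]
    have key := h L L'
    have s1 : ∑ x ∈ Λ \ {1, -1}, ((L x : ℝ) - L' x) * Real.arccos x
        = ∑ x ∈ Λ \ {1, -1}, ((l x : ℝ) - l' x) * Real.arccos x :=
      Finset.sum_congr rfl fun x hx => by rw [hL x hx, hL' x hx]
    have s2 : ∑ x ∈ Λ \ {1, -1}, (L x + L' x) = ∑ x ∈ Λ \ {1, -1}, (l x + l' x) :=
      Finset.sum_congr rfl fun x hx => by rw [hL x hx, hL' x hx]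
    have s3 : ∑ x ∈ Λ \ {1, -1}, κ x * (L x + L' x)
        = ∑ x ∈ Λ \ {1, -1}, κ x * (l x + l' x) :=
      Finset.sum_congr rfl fun x hx => by rw [hL x hx, hL' x hx]
    rw [sum_eq_sum_sdiff_pm_one Λ, sum_eq_sum_sdiff_pm_one Λ, sum_eq_sum_sdiff_pm_one Λ,
      s1, s2, s3, e1, e2, e1', e2'] at key
    simp only [Real.arccos_one, Real.arccos_neg_one, mul_zero, ite_self, add_zero, Int.cast_zero,
      sub_zero] at key
    exact key h1 h2
  · intro h l l' h1 h2
    rw [sum_eq_sum_sdiff_pm_one] at h1 h2 ⊢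
    refine h l l' (l 1 + l' 1) (l (-1) + l' (-1)) ?_ h2
    refine AddCommGroup.ModEq.trans ?_ h1
    rw [Real.arccos_one, Real.arccos_neg_one, mul_zero, ite_self, add_zero]
    -- at `-1` the angle sums with `l + l'` and with `l - l'` differ by a multiple of `2 π`
    refine AddCommGroup.ModEq.add AddCommGroup.modEq_rfl ?_
    split_ifs
    · rw [AddCommGroup.modEq_iff_zsmul']
      refine ⟨-l' (-1), ?_⟩
      simp only [zsmul_eq_mul]
      push_cast
      ring
    · exact AddCommGroup.modEq_rfl

/-! ### Phase classes -/

section PhaseClass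

variable {V : Type*} [Fintype V] [DecidableEq V] {H : Matrix V V ℂ} {m : ℕ} {a b : V}

theorem mem_phaseClass {k : ℤ} {x : ℝ} :
    x ∈ phaseClass H m a b k ↔ x ∈ eigenvalueSupport H a ∧
      eigenProj H x a = (Circle.exp (2 * Real.pi * k / m) : ℂ) • eigenProj H x b := by
  have : (Circle.exp (2 * Real.pi * k / m) : ℂ)
      = Complex.exp (2 * Real.pi * Complex.I * k / m) := by
    rw [Circle.coe_exp]
    push_cast
    ring_nf
  simp [phaseClass, this]

theorem exists_mem_phaseClass (hab : MStronglyCospectral H m a b) {x : ℝ}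
    (hx : x ∈ eigenvalueSupport H a) : ∃ k : ℕ, k < m ∧ x ∈ phaseClass H m a b k := by
  obtain ⟨hm, α, hα, -⟩ := hab
  obtain ⟨h1, h2⟩ := hα x hx
  have : NeZero m := ⟨hm.ne'⟩
  obtain ⟨k, hk, hkα⟩ := (Complex.isPrimitiveRoot_exp m hm.ne').eq_pow_of_pow_eq_one h1
  refine ⟨k, hk, mem_phaseClass.mpr ⟨hx, ?_⟩⟩
  rw [h2, ← hkα, ← Complex.exp_nat_mul, Circle.coe_exp]
  congr 2
  push_cast
  ring

theorem modEq_of_mem_phaseClass (hm : 0 < m) {x : ℝ} {j k : ℤ}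
    (hj : x ∈ phaseClass H m a b j) (hk : x ∈ phaseClass H m a b k) : j ≡ k [ZMOD m] := by
  obtain ⟨hx, hj⟩ := mem_phaseClass.mp hj
  obtain ⟨-, hk⟩ := mem_phaseClass.mp hk
  have hb : eigenProj H x b ≠ 0 := fun h0 =>
    mem_eigenvalueSupport.mp hx (by rw [hj, h0, smul_zero])
  have h := Circle.coe_inj.mp (smul_left_injective ℂ hb (hj.symm.trans hk))
  have h' : Circle.exp (2 * Real.pi * (j - k : ℤ) / m) = 1 := by
    push_cast
    rw [mul_sub, sub_div, Circle.exp_sub, h, div_self']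
  have := (circle_exp_two_pi_mul_div_eq_one_iff hm _).mp h'
  rw [Int.modEq_zero_iff_dvd] at this
  exact (Int.modEq_iff_dvd.mpr this).symm

/-- Outside `S` the indices `κ` are the representatives below `m`, so the classes with index below
`m` are there the fibres of `κ`. -/
theorem sum_mul_sum_phaseClass (hm : 0 < m) {κ : ℝ → ℤ}
    (hκ : ∀ x ∈ eigenvalueSupport H a, x ∈ phaseClass H m a b (κ x)) (S : Finset ℝ)
    (hκm : ∀ x ∈ eigenvalueSupport H a \ S, ∃ k : ℕ, k < m ∧ κ x = k) (g : ℝ → ℤ) :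
    ∑ k ∈ Finset.range m, (k : ℤ) * ∑ x ∈ phaseClass H m a b k \ S, g x =
      ∑ x ∈ eigenvalueSupport H a \ S, κ x * g x := by
  classical
  have hcls : ∀ k ∈ Finset.range m, phaseClass H m a b k \ S
      = (eigenvalueSupport H a \ S).filter fun x => (κ x).toNat = k := by
    intro k hk
    ext x
    simp only [Finset.mem_sdiff, Finset.mem_filter]
    constructor
    · rintro ⟨hx, hxS⟩
      have hxa := (mem_phaseClass.mp hx).1
      refine ⟨⟨hxa, hxS⟩, ?_⟩
      obtain ⟨j, hj, hjκ⟩ := hκm x (Finset.mem_sdiff.mpr ⟨hxa, hxS⟩)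
      have := modEq_of_mem_phaseClass hm hx (hκ x hxa)
      rw [hjκ, Int.natCast_modEq_iff] at this
      rw [hjκ, Int.toNat_natCast]
      exact (this.eq_of_lt_of_lt (Finset.mem_range.mp hk) hj).symm
    · rintro ⟨⟨hxa, hxS⟩, rfl⟩
      refine ⟨?_, hxS⟩
      obtain ⟨j, hj, hjκ⟩ := hκm x (Finset.mem_sdiff.mpr ⟨hxa, hxS⟩)
      have := hκ x hxa
      rw [hjκ] at this ⊢
      simpa using this
  have hmaps : ∀ x ∈ eigenvalueSupport H a \ S, (κ x).toNat ∈ Finset.range m := by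
    intro x hx
    obtain ⟨j, hj, hjκ⟩ := hκm x hx
    simpa [hjκ] using hj
  rw [← Finset.sum_fiberwise_of_maps_to hmaps]
  refine Finset.sum_congr rfl fun k hk => ?_
  rw [hcls k hk, Finset.mul_sum]
  refine Finset.sum_congr rfl fun x hx => ?_
  obtain ⟨hx', rfl⟩ := Finset.mem_filter.mp hx
  obtain ⟨j, -, hjκ⟩ := hκm x hx'
  simp [hjκ]

end PhaseClass

/-! ### The criterion for pretty good state transfer -/

theorem mainTheorem4 {V : Type*} [Fintype V] [DecidableEq V]
    (G : SimpleGraph V) [DecidableRel G.Adj]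
    (W : Matrix V V ℂ) (hW : IsNormalizedAdjacency G W)
    (H : Matrix V V ℂ) (hH : H = hermitianAdjacency W)
    (m : ℕ) (a b : V) (hab : MStronglyCospectral H m a b)
    -- `σ₁` and `σ₂` are the class indices of the eigenvalues `1` and `-1`, where these lie in `Λ_a`
    (σ₁ σ₂ : ℤ)
    (hσ₁ : (1 : ℝ) ∈ eigenvalueSupport H a → (1 : ℝ) ∈ phaseClass H m a b σ₁)
    (hσ₂ : (-1 : ℝ) ∈ eigenvalueSupport H a → (-1 : ℝ) ∈ phaseClass H m a b σ₂) :
    (PrettyGoodStateTransfer (transition G W) (vertexState G W a) (vertexState G W b) ↔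
      PrettyGoodStateTransfer (transition G W) (vertexState G W b) (vertexState G W a)) ∧
    (PrettyGoodStateTransfer (transition G W) (vertexState G W a) (vertexState G W b) ↔
      -- `l₁` and `l₂` are the integers attached to the eigenvalues `1` and `-1`
      ∀ (l l' : ℝ → ℤ) (l₁ l₂ : ℤ),
        ((∑ x ∈ eigenvalueSupport H a \ {1, -1}, ((l x : ℝ) - (l' x : ℝ)) * Real.arccos x)
            + (l₂ : ℝ) * (supportIndicator H a (-1) : ℝ) * Real.pi ≡ 0 [PMOD (2 * Real.pi)]) →
        ((∑ x ∈ eigenvalueSupport H a \ {1, -1}, (l x + l' x))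
            + l₁ * supportIndicator H a 1 + l₂ * supportIndicator H a (-1) = 0) →
        ((∑ k ∈ Finset.range m, (k : ℤ) * (∑ x ∈ phaseClass H m a b k \ {1, -1}, (l x + l' x)))
            + l₁ * supportIndicator H a 1 * σ₁ + l₂ * supportIndicator H a (-1) * σ₂
          ≡ 0 [ZMOD m])) := by
  have hUU := conjTranspose_transition_mul_self G hW
  refine ⟨⟨prettyGoodStateTransfer_symm hUU, prettyGoodStateTransfer_symm hUU⟩, ?_⟩
  have hm : 0 < m := hab.1
  -- class indices: `σ₁` and `σ₂` at `1` and `-1`, representatives below `m` elsewhere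
  have hκex : ∀ x, ∃ k : ℤ, (x ∈ eigenvalueSupport H a → x ∈ phaseClass H m a b k) ∧
      (x = 1 → k = σ₁) ∧ (x = -1 → k = σ₂) ∧
      (x ∈ eigenvalueSupport H a \ {1, -1} → ∃ j : ℕ, j < m ∧ k = j) := by
    intro x
    by_cases hx1 : x = 1
    · subst hx1
      exact ⟨σ₁, hσ₁, fun _ => rfl, fun h => by norm_num at h, fun h => by simp at h⟩
    by_cases hx2 : x = -1
    · subst hx2
      exact ⟨σ₂, hσ₂, fun h => absurd h hx1, fun _ => rfl, fun h => by simp at h⟩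
    by_cases hx : x ∈ eigenvalueSupport H a
    · obtain ⟨k, hk, hxk⟩ := exists_mem_phaseClass hab hx
      exact ⟨k, fun _ => hxk, fun h => absurd h hx1, fun h => absurd h hx2, fun _ => ⟨k, hk, rfl⟩⟩
    · exact ⟨0, fun h => absurd h hx, fun h => absurd h hx1, fun h => absurd h hx2,
        fun h => absurd (Finset.mem_sdiff.mp h).1 hx⟩
  choose κ hκ hκ₁ hκ₂ hκm using hκex
  rw [prettyGoodStateTransfer_iff_exists_phase G hW
      (c := fun x => Circle.exp (2 * Real.pi * κ x / m))
      fun x hx => (mem_phaseClass.mp (hH ▸ hκ x (hH ▸ hx))).2,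
    ← hH, exists_phase_iff_forall_int hm, forall_int_iff_separate_pm_one]
  refine forall₄_congr fun l l' l₁ l₂ => ?_
  rw [sum_mul_sum_phaseClass hm hκ _ hκm, hκ₁ 1 rfl, hκ₂ (-1) rfl]
  simp only [supportIndicator]
  split_ifs <;> simp [mul_comm]
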